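/- **Lemma.** Let $n,d\ge 0$ be integers; no relation between $n$ and $d$ is assumed, so the singular case $d<n$ is included. For a symmetric positive definite $M\in\mathbb R^{n\times n}$ let $\mathcal{MN}(0,M,I_d)$ be the matrix normal law on $\mathbb R^{n\times d}$ (centred, jointly Gaussian entries, $\operatorname{Cov}(F_{ij},F_{kl})=M_{ik}\,\delta_{jl}$), and let $\mathcal W(M,d)$ be the (possibly singular) Wishart law, i.e. the law of $\sum_{j=1}^d y_jy_j^T$ with $y_1,\dots,y_d$ independent $\mathcal N(0,M)$ vectors. Let $\lambda$ be Lebesgue measure on $\mathbb R^{n\times d}$. Let $\nu$ be the following measure on $n\times n$ matrices: if $d\ge n$, Lebesgue measure $\prod_{i\le j}dT_{ij}$ on symmetric matrices; if $d<n$, the volume measure on the manifold of positive semidefinite matrices of rank $d$, i.e. the Hausdorff measure of dimension $d(d+1)/2+(n-d)d$ for the Frobenius norm, restricted to that manifold. Then: 1. For every positive definite $M$, $\mathcal{MN}(0,M,I_d)$ has a density $p(F\mid M)$ with respect to $\lambda$ and $\mathcal W(M,d)$ has a density $p(T\mid M)$ with respect to $\nu$. The densities can be chosen such that $M\mapsto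 p(F\mid M)$ and $M\mapsto p(T\mid M)$ are continuous on the positive definite matrices, for every $F$ and every $T$. 2. For any choice of (measurable, nonnegative, finite) versions of these densities there is a function $c:\mathbb R^{n\times d}\to\mathbb R$, not depending on $M$, such that, for $T=FF^T$, both $p(F\mid M)$ and $p(T\mid M)$ are positive and $$\log p(F\mid M)=\log p(T\mid M)+c(F)\qquad(\ast)$$ in each of the following senses: (a) for every positive definite $M$, $(\ast)$ holds for $\lambda$-almost every $F$; (b) if the versions are continuous in $M$ as in part 1, then for $\lambda$-almost every $F$, $(\ast)$ holds for all positive definite $M$ simultaneously; (c) if, for every positive definite $M$, $p(\cdot\mid M)$ is continuous on $\mathbb R^{n\times d}$ in the matrix normal case, and continuous and positive on the positive semidefinite matrices of rank $\min(n,d)$ in the Wishart case, then $(\ast)$ holds for every $F$ of rank $\min(n,d)$ and every positive definite $M$. -/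

import Mathlib

open MeasureTheory ProbabilityTheory
open scoped Matrix Kronecker

/-- Real matrices carry the product sigma-algebra of their entries. -/
instance Matrix.instMeasurableSpaceReal {m n : Type*} : MeasurableSpace (Matrix m n ℝ) :=
  inferInstanceAs (MeasurableSpace (m → n → ℝ))

/-- Lebesgue measure on real `m × n` matrices: the product of the Lebesgue measures of the
entries. -/
noncomputable instance Matrix.instMeasureSpaceReal {m n : Type*} [Fintype m] [Fintype n] :
    MeasureSpace (Matrix m n ℝ) where
  volume := (volume : Measure (m → n → ℝ))

namespace WishartModel

/-- The matrix with the given (doubly indexed) entries. -/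
def toMatrix {n d : ℕ} (x : EuclideanSpace ℝ (Fin n × Fin d)) : Matrix (Fin n) (Fin d) ℝ :=
  Matrix.of fun i j => x (i, j)

/-- The matrix normal law `MN(A, U, V)`: the entries of the random matrix `F` are jointly
Gaussian with mean `A` and `Cov(F i j, F k l) = U i k * V j l`. -/
noncomputable def matrixNormal {n d : ℕ} (A : Matrix (Fin n) (Fin d) ℝ)
    (U : Matrix (Fin n) (Fin n) ℝ) (V : Matrix (Fin d) (Fin d) ℝ) :
    Measure (Matrix (Fin n) (Fin d) ℝ) :=
  (multivariateGaussian (WithLp.toLp 2 fun p : Fin n × Fin d => A p.1 p.2) (U ⊗ₖ V)).map toMatrix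

/-- The (possibly singular) Wishart law `W(M, d)`: the law of `∑ j, y j (y j)ᵀ`, where
`y 1, …, y d` are independent `N(0, M)` vectors. No relation between `d` and `n` is assumed. -/
noncomputable def wishart {n : ℕ} (M : Matrix (Fin n) (Fin n) ℝ) (d : ℕ) :
    Measure (Matrix (Fin n) (Fin n) ℝ) :=
  (Measure.pi fun _ : Fin d =>
      (multivariateGaussian 0 M : Measure (EuclideanSpace ℝ (Fin n)))).map
    fun y => ∑ j, Matrix.vecMulVec (fun i => y j i) (fun i => y j i)

/-- The symmetric matrix with the given entries on and above the diagonal. -/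
def symmetricOfUpper {n : ℕ} (u : {p : Fin n × Fin n // p.1 ≤ p.2} → ℝ) :
    Matrix (Fin n) (Fin n) ℝ :=
  Matrix.of fun i j => if h : i ≤ j then u ⟨(i, j), h⟩ else u ⟨(j, i), le_of_not_ge h⟩

/-- The positive semidefinite `n × n` matrices of rank `r`. -/
def psdOfRank (n r : ℕ) : Set (Matrix (Fin n) (Fin n) ℝ) :=
  {T | T.PosSemidef ∧ T.rank = r}

/-- The reference measure for densities of `W(M, d)` on `n × n` matrices. If `n ≤ d`, it is the
Lebesgue measure `∏_{i ≤ j} dT i j` on symmetric matrices. If `d < n` (the singular case), it is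
the volume measure of the manifold of positive semidefinite matrices of rank `d`, that is, the
Hausdorff measure (for the Frobenius norm) of dimension `d (d + 1) / 2 + (n - d) d`, which is the
dimension of that manifold. -/
noncomputable def wishartReference (n d : ℕ) : Measure (Matrix (Fin n) (Fin n) ℝ) :=
  if n ≤ d then
    (volume : Measure ({p : Fin n × Fin n // p.1 ≤ p.2} → ℝ)).map symmetricOfUpper
  else
    ((μHE[d * (d + 1) / 2 + (n - d) * d] :
        Measure (EuclideanSpace ℝ (Fin n × Fin n))).map toMatrix).restrict (psdOfRank n d)

/-- `p x M = p(x | M)` is a (version of the) density of `P M` with respect to `ν`, for every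
positive definite parameter matrix `M`. -/
def IsDensityFamily {n : ℕ} {α : Type*} [MeasurableSpace α]
    (P : Matrix (Fin n) (Fin n) ℝ → Measure α) (ν : Measure α)
    (p : α → Matrix (Fin n) (Fin n) ℝ → ℝ) : Prop :=
  ∀ M : Matrix (Fin n) (Fin n) ℝ, M.PosDef →
    Measurable (fun x => p x M) ∧ (∀ x, 0 ≤ p x M) ∧
      P M = ν.withDensity fun x => ENNReal.ofReal (p x M)

/-- The likelihood function `M ↦ p(x | M)` of every observation `x` is continuous on the positive
definite matrices. -/
def ContinuousInParameter {n : ℕ} {α : Type*} (p : α → Matrix (Fin n) (Fin n) ℝ → ℝ) : Prop :=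
  ∀ x, ContinuousOn (p x) {M | M.PosDef}

/-- At the data `F`, and `T = F Fᵀ`, both likelihoods at `M` are positive, and the
log-likelihoods differ by `c`: `log p(F | M) = log p(T | M) + c`. -/
def LogLikelihoodsAgree {n d : ℕ}
    (pF : Matrix (Fin n) (Fin d) ℝ → Matrix (Fin n) (Fin n) ℝ → ℝ)
    (pT : Matrix (Fin n) (Fin n) ℝ → Matrix (Fin n) (Fin n) ℝ → ℝ)
    (F : Matrix (Fin n) (Fin d) ℝ) (M : Matrix (Fin n) (Fin n) ℝ) (c : ℝ) : Prop :=
  0 < pF F M ∧ 0 < pT (F * Fᵀ) M ∧ Real.log (pF F M) = Real.log (pT (F * Fᵀ) M) + c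

end WishartModel

/-! The density of the matrix normal law is `K * w(M, F Fᵀ)` with `w(M, T) = det(M)^(-d/2)
exp(-tr(M⁻¹ T)/2)`, so `T = F Fᵀ` is a sufficient statistic, and the Wishart law is the image of the
matrix normal law under `F ↦ F Fᵀ`. Hence `W(M, d)` has density `w(M, T) / w(1, T)` with respect to
`W(1, d)`. Once `W(1, d)` is known to have a density with respect to `ν`, all Wishart densities take
the form `h(T) * w(M, T)`, and the ratio of the two likelihoods is free of `M`. The explicit form of
`h` is never needed.

What remains is geometric. Absolute continuity (`map_mul_transpose_absolutelyContinuous`): suitable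
entries of `F Fᵀ`, as many as the dimension of `ν`, form a submersion at almost every `F`, so null
sets pull back to null sets. In the singular case, projecting to these entries is 1-Lipschitz and so
sends Hausdorff null sets to Lebesgue null sets. Sigma-finiteness of `ν`
(`sigmaFinite_wishartReference`): countably many Lipschitz images of balls cover the symmetric
matrices of rank `d`. It gives existence of the Radon-Nikodym density and uniqueness of versions. -/

/-! ### Null sets under submersions -/

open Filter Topology in
/-- Null sets pull back to null sets along a `C¹` map, on any set of points where the map is a
submersion. -/
theorem measure_inter_preimage_eq_zero_of_surjective_fderiv {E F : Type*}
    [NormedAddCommGroup E] [NormedSpace ℝ E] [FiniteDimensional ℝ E]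
    [MeasurableSpace E] [BorelSpace E]
    [NormedAddCommGroup F] [NormedSpace ℝ F] [FiniteDimensional ℝ F]
    [MeasurableSpace F] [BorelSpace F]
    (μ : Measure E) [μ.IsAddHaarMeasure] (ν : Measure F) [ν.IsAddHaarMeasure]
    {f : E → F} (hf : ContDiff ℝ 1 f) {S : Set E}
    (hS : ∀ x ∈ S, Function.Surjective (fderiv ℝ f x)) {Z : Set F} (hZ : ν Z = 0) :
    μ (S ∩ f ⁻¹' Z) = 0 := by
  refine measure_null_of_locally_null _ fun x hx => ?_
  have : CompleteSpace E := FiniteDimensional.complete ℝ E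
  have : CompleteSpace F := FiniteDimensional.complete ℝ F
  set f' := fderiv ℝ f x with hf'
  have hsurj : f'.range = ⊤ := LinearMap.range_eq_top.2 (hS x hx.1)
  obtain ⟨p, hp⟩ := f'.ker_closedComplemented_of_finiteDimensional_range
  let A : E ≃L[ℝ] F × f'.ker := f'.equivProdOfSurjectiveOfIsCompl p hsurj
    (LinearMap.range_eq_top.2 fun y => ⟨y, hp y⟩) (LinearMap.isCompl_of_proj hp)
  -- Completing `f` by a projection onto the kernel of its derivative gives a local diffeomorphism.
  -- Its local inverse `g` parametrizes `f ⁻¹' Z` near `x` by part of `Z × ker`.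
  let Φ : E → F × f'.ker := fun y => (f y, p y)
  have hΦ : ContDiffAt ℝ 1 Φ x := (hf.prodMk p.contDiff).contDiffAt
  have hΦ' : HasFDerivAt Φ (A : E →L[ℝ] F × f'.ker) x := by
    have h1 := ((hf.differentiable one_ne_zero x).hasFDerivAt).prodMk p.hasFDerivAt (x := x)
    exact h1
  let g := hΦ.localInverse hΦ' one_ne_zero
  have hg : ContDiffAt ℝ 1 g (Φ x) := hΦ.to_localInverse hΦ' one_ne_zero
  obtain ⟨V, hV, hgV⟩ : ∃ V ∈ 𝓝 (Φ x), DifferentiableOn ℝ g V := by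
    obtain ⟨V, hV, h⟩ := hg.contDiffOn (m := 1) le_rfl (by simp)
    refine ⟨V, ?_, h.differentiableOn one_ne_zero⟩
    simpa using hV
  have hleft : ∀ᶠ y in 𝓝 x, g (Φ y) = y :=
    (hΦ.hasStrictFDerivAt' hΦ' one_ne_zero).eventually_left_inverse
  refine ⟨S ∩ f ⁻¹' Z ∩ {y | g (Φ y) = y ∧ Φ y ∈ V}, ?_, ?_⟩
  · exact inter_mem_nhdsWithin _ (hleft.and (hΦ.continuousAt hV))
  -- Composing with `A` turns `g` into a differentiable map from `E` to itself, and such maps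
  -- preserve null sets.
  refine measure_mono_null (t := (g ∘ A) '' (A ⁻¹' (V ∩ Z ×ˢ Set.univ))) ?_ ?_
  · rintro y ⟨⟨-, hy⟩, hy1, hy2⟩
    exact ⟨A.symm (Φ y), by simpa [hy2] using hy, by simpa using hy1⟩
  · refine addHaar_image_eq_zero_of_differentiableOn_of_addHaar_eq_zero μ ?_ ?_
    · exact hgV.comp A.differentiable.differentiableOn fun y hy => hy.1
    · let κ : Measure f'.ker := Measure.addHaar
      have h0 : (ν.prod κ) (Z ×ˢ Set.univ) = 0 := by rw [Measure.prod_prod, hZ, zero_mul]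
      have : (μ.map A).IsAddHaarMeasure := A.isAddHaarMeasure_map μ
      have h1 : (μ.map A) (Z ×ˢ Set.univ) = 0 :=
        Measure.absolutelyContinuous_isAddHaarMeasure (μ.map A) (ν.prod κ) h0
      have h2 : μ.map A = μ.map A.toHomeomorph.toMeasurableEquiv := rfl
      rw [h2, MeasurableEquiv.map_apply] at h1
      exact measure_mono_null (fun y hy => hy.2) h1

/-! ### Submersivity of the entries of `F Fᵀ` -/

namespace WishartModel

instance {m n : Type*} [Fintype m] [Fintype n] : BorelSpace (Matrix m n ℝ) :=
  inferInstanceAs (BorelSpace (m → n → ℝ))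

instance {m n : Type*} [Fintype m] [Fintype n] :
    SigmaFinite (volume : Measure (Matrix m n ℝ)) :=
  inferInstanceAs (SigmaFinite (volume : Measure (m → n → ℝ)))

instance {m n : Type*} [Fintype m] [Fintype n] :
    (volume : Measure (Matrix m n ℝ)).IsOpenPosMeasure :=
  inferInstanceAs ((volume : Measure (m → n → ℝ)).IsOpenPosMeasure)

/-- Almost every matrix has a nonzero minor at a given place. -/
theorem ae_det_submatrix_ne_zero {n d r : ℕ} {e : Fin r → Fin n} {e' : Fin r → Fin d}
    (he : Function.Injective e) (he' : Function.Injective e') :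
    ∀ᵐ F : Matrix (Fin n) (Fin d) ℝ, (F.submatrix e e').det ≠ 0 := by
  classical
  -- Along the direction `G` the chosen submatrix moves by multiples of the identity. Its
  -- determinant is then a characteristic polynomial in `t`, so each line in this direction meets
  -- the bad set in finitely many points.
  let G : Fin n → Fin d → ℝ := fun i j => if ∃ a, i = e a ∧ j = e' a then 1 else 0
  have hG : (Matrix.of G).submatrix e e' = 1 := by
    ext a b
    simp [G, Matrix.one_apply, he.eq_iff, he'.eq_iff, eq_comm]
  refine ae_mem_of_ae_add_linearMap_mem (E := ℝ) (F := Fin n → Fin d → ℝ) (𝕜 := ℝ)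
    (LinearMap.toSpanSingleton ℝ _ G) volume volume
    (s := {F | ((Matrix.of F).submatrix e e').det ≠ 0}) ?_ fun F => ?_
  · refine (isOpen_ne.preimage ?_).measurableSet
    refine Continuous.matrix_det (Continuous.matrix_submatrix ?_ _ _)
    exact continuous_id
  · rw [ae_iff]
    refine Set.Countable.measure_zero (Set.Finite.countable ?_) volume
    refine (Polynomial.finite_setOfPred_isRoot
      ((-(Matrix.of F).submatrix e e').charpoly_monic.ne_zero)).subset fun t ht => ?_
    have ht : (((Matrix.of (F + t • G)).submatrix e e')).det = 0 := by simpa using ht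
    have h1 : (Matrix.of (F + t • G)).submatrix e e'
        = Matrix.scalar (Fin r) t - -(Matrix.of F).submatrix e e' := by
      have : (Matrix.of (F + t • G)).submatrix e e'
        = (Matrix.of F).submatrix e e' + t • (Matrix.of G).submatrix e e' := rfl
      rw [this, hG, sub_neg_eq_add, add_comm, Matrix.scalar_apply, Matrix.smul_one_eq_diagonal]
    rw [h1, ← Matrix.eval_charpoly] at ht
    exact ht

/-- The entries of `F * Fᵀ` at the places listed by `q`. -/
def gramEntries {J : Type*} {n d : ℕ} (q : J → Fin n × Fin n) (F : Fin n → Fin d → ℝ) : J → ℝ :=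
  fun x => ∑ j, F (q x).1 j * F (q x).2 j

theorem contDiff_gramEntries {J : Type*} [Fintype J] {n d : ℕ} (q : J → Fin n × Fin n) :
    ContDiff ℝ 1 (gramEntries q : (Fin n → Fin d → ℝ) → J → ℝ) := by
  unfold gramEntries
  fun_prop

theorem fderiv_gramEntries {J : Type*} [Fintype J] {n d : ℕ} (q : J → Fin n × Fin n)
    (F H : Fin n → Fin d → ℝ) :
    fderiv ℝ (gramEntries q) F H =
      fun x => ∑ j, (H (q x).1 j * F (q x).2 j + F (q x).1 j * H (q x).2 j) := by
  have h1 : HasDerivAt (fun t : ℝ => gramEntries q (F + t • H)) (fderiv ℝ (gramEntries q) F H) 0 :=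
    ((contDiff_gramEntries q).differentiable one_ne_zero F).hasFDerivAt.hasLineDerivAt H
  refine h1.unique (hasDerivAt_pi.2 fun x => ?_)
  refine HasDerivAt.fun_sum fun j _ => ?_
  have h2 : ∀ i, HasDerivAt (fun t : ℝ => (F + t • H) i j) (H i j) 0 := fun i => by
    simpa using ((hasDerivAt_id (0 : ℝ)).mul_const (H i j)).const_add (F i j)
  simpa using (h2 (q x).1).fun_mul (h2 (q x).2)

theorem symmetricOfUpper_isSymm {n : ℕ} (u : {p : Fin n × Fin n // p.1 ≤ p.2} → ℝ) :
    (symmetricOfUpper u).IsSymm := by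
  ext i j
  rcases lt_trichotomy i j with h | rfl | h
  · simp [symmetricOfUpper, h.le, h.not_ge]
  · rfl
  · simp [symmetricOfUpper, h.le, h.not_ge]

theorem symmetricOfUpper_apply {n : ℕ} (u : {p : Fin n × Fin n // p.1 ≤ p.2} → ℝ)
    (p : {p : Fin n × Fin n // p.1 ≤ p.2}) : symmetricOfUpper u p.1.1 p.1.2 = u p := by
  simp [symmetricOfUpper, p.2]

theorem symmetricOfUpper_entries {n : ℕ} {T : Matrix (Fin n) (Fin n) ℝ} (hT : T.IsSymm) :
    symmetricOfUpper (fun p => T p.1.1 p.1.2) = T := by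
  ext i j
  by_cases h : i ≤ j
  · simp [symmetricOfUpper, h]
  · simpa [symmetricOfUpper, h] using hT.apply i j

/-- If the rows `e` of `F` are linearly independent, then the infinitesimal variation of these rows
of `F * Fᵀ` can be prescribed. -/
theorem exists_variation_eq {n d r : ℕ} {e : Fin r → Fin n} {F : Matrix (Fin n) (Fin d) ℝ}
    {R : Matrix (Fin d) (Fin r) ℝ} (hR : F.submatrix e id * R = 1)
    {S : Matrix (Fin n) (Fin n) ℝ} (hS : S.IsSymm) :
    ∃ H : Matrix (Fin n) (Fin d) ℝ, (H * Fᵀ + F * Hᵀ).submatrix e id = S.submatrix e id := by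
  obtain ⟨P, hP⟩ : ∃ P, P = F * R := ⟨_, rfl⟩
  -- With `H = Q Rᵀ` and `P = F R` the variation is `Q Pᵀ + P Qᵀ`. As the rows `e` of `P` form the
  -- identity, asking for the rows `e` of `S`, with `½ S_ee` as the rows `e` of `Q`, forces this
  -- `Q`.
  set Q := S.submatrix id e - (1 / 2 : ℝ) • (P * S.submatrix e e) with hQ
  refine ⟨Q * Rᵀ, ?_⟩
  have hPe : P.submatrix e id = 1 := by
    rw [← hR, hP]; rfl
  have hSee : (S.submatrix e e)ᵀ = S.submatrix e e := by
    rw [Matrix.transpose_submatrix, hS.eq]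
  have hQe : Q.submatrix e id = (1 / 2 : ℝ) • S.submatrix e e := by
    have h : Q.submatrix e id
        = S.submatrix e e - (1 / 2 : ℝ) • (P.submatrix e id * S.submatrix e e) := rfl
    rw [h, hPe, Matrix.one_mul]
    module
  have h1 : Q * Rᵀ * Fᵀ + F * (Q * Rᵀ)ᵀ = Q * Pᵀ + P * Qᵀ := by
    simp [hP, Matrix.mul_assoc]
  have h2 : (Q * Pᵀ + P * Qᵀ).submatrix e id
      = Q.submatrix e id * Pᵀ + P.submatrix e id * Qᵀ := rfl
  rw [h1, h2, hQe, hPe, Matrix.one_mul, hQ]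
  rw [Matrix.transpose_sub, Matrix.transpose_smul, Matrix.transpose_mul, hSee,
    Matrix.transpose_submatrix, hS.eq, Matrix.smul_mul]
  abel

theorem surjective_fderiv_gramEntries {J : Type*} [Fintype J] {n d r : ℕ}
    {q : J → Fin n × Fin n} (hq : Function.Injective q) (hle : ∀ x, (q x).1 ≤ (q x).2)
    {e : Fin r → Fin n} (he : ∀ x, ∃ a, e a = (q x).1) {F : Fin n → Fin d → ℝ}
    {R : Matrix (Fin d) (Fin r) ℝ} (hR : (Matrix.of F).submatrix e id * R = 1) :
    Function.Surjective (fderiv ℝ (gramEntries q) F) := by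
  intro s
  obtain ⟨H, hH⟩ := exists_variation_eq hR
    (symmetricOfUpper_isSymm fun p => Function.extend q s 0 p.1)
  refine ⟨fun i j => H i j, ?_⟩
  rw [fderiv_gramEntries]
  funext x
  obtain ⟨a, ha⟩ := he x
  have h1 := congrFun (congrFun hH a) (q x).2
  rw [Matrix.submatrix_apply, Matrix.submatrix_apply, ha, id,
    symmetricOfUpper_apply _ ⟨q x, hle x⟩, hq.extend_apply] at h1
  rw [← h1, Matrix.add_apply, Matrix.mul_apply, Matrix.mul_apply, ← Finset.sum_add_distrib]
  rfl

theorem exists_right_inverse_of_det_submatrix_ne_zero {n d r : ℕ} {e : Fin r → Fin n}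
    {e' : Fin r → Fin d} {F : Matrix (Fin n) (Fin d) ℝ} (h : (F.submatrix e e').det ≠ 0) :
    ∃ R : Matrix (Fin d) (Fin r) ℝ, F.submatrix e id * R = 1 := by
  refine ⟨(1 : Matrix (Fin d) (Fin d) ℝ).submatrix id e' * (F.submatrix e e')⁻¹, ?_⟩
  rw [← Matrix.mul_assoc]
  have h1 : F.submatrix e id * (1 : Matrix (Fin d) (Fin d) ℝ).submatrix id e'
      = F.submatrix e e' := by
    have : F.submatrix e id * (1 : Matrix (Fin d) (Fin d) ℝ).submatrix id e'
      = (F * (1 : Matrix (Fin d) (Fin d) ℝ)).submatrix e e' := rfl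
    rw [this, Matrix.mul_one]
  rw [h1, Matrix.mul_nonsing_inv _ (isUnit_iff_ne_zero.2 h)]

theorem rank_eq_min_of_det_submatrix_ne_zero {n d : ℕ} {e : Fin (min n d) → Fin n}
    {e' : Fin (min n d) → Fin d} {F : Matrix (Fin n) (Fin d) ℝ}
    (h : (F.submatrix e e').det ≠ 0) : F.rank = min n d := by
  refine le_antisymm (le_min ?_ ?_) ?_
  · simpa using F.rank_le_card_height
  · simpa using F.rank_le_card_width
  · have h1 := Matrix.rank_of_isUnit _ ((Matrix.isUnit_iff_isUnit_det _).2 (isUnit_iff_ne_zero.2 h))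
    rw [Fintype.card_fin] at h1
    rw [← h1]
    exact Matrix.rank_submatrix_le _ _ _

/-- For almost every `F`, the matrix `F * Fᵀ` does not have its entries at the (upper triangular)
places listed by `q` in a given null set. -/
theorem ae_gramEntries_notMem {J : Type*} [Fintype J] {n d : ℕ}
    {q : J → Fin n × Fin n} (hq : Function.Injective q) (hle : ∀ x, (q x).1 ≤ (q x).2)
    (hlt : ∀ x, ((q x).1 : ℕ) < d) {Z : Set (J → ℝ)} (hZ : volume Z = 0) :
    ∀ᵐ F : Matrix (Fin n) (Fin d) ℝ, gramEntries q F ∉ Z := by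
  -- Almost surely the first `min n d` rows are independent, and by `hlt` every listed place lies in
  -- one of them.
  let e : Fin (min n d) → Fin n := Fin.castLE (min_le_left n d)
  let e' : Fin (min n d) → Fin d := Fin.castLE (min_le_right n d)
  have h1 := ae_det_submatrix_ne_zero (e := e) (e' := e') (Fin.castLE_injective _)
    (Fin.castLE_injective _)
  have h2 := measure_inter_preimage_eq_zero_of_surjective_fderiv
    (volume : Measure (Fin n → Fin d → ℝ)) (volume : Measure (J → ℝ)) (contDiff_gramEntries q)
    (S := {F | ((Matrix.of F).submatrix e e').det ≠ 0}) (fun F hF => by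
      obtain ⟨R, hR⟩ := exists_right_inverse_of_det_submatrix_ne_zero hF
      exact surjective_fderiv_gramEntries hq hle
        (fun x => ⟨⟨(q x).1, lt_min (q x).1.2 (hlt x)⟩, rfl⟩) hR) hZ
  have h3 : ∀ᵐ F : Matrix (Fin n) (Fin d) ℝ,
      ¬ ((F.submatrix e e').det ≠ 0 ∧ gramEntries q F ∈ Z) := measure_eq_zero_iff_ae_notMem.1 h2
  filter_upwards [h1, h3] with F hF hF' hZ
  exact hF' ⟨hF, hZ⟩

end WishartModel

/-! ### Absolute continuity with respect to the reference measure -/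

namespace WishartModel

theorem continuous_toMatrix (n d : ℕ) : Continuous (toMatrix (n := n) (d := d)) := by
  refine continuous_matrix fun i j => ?_
  simp only [toMatrix, Matrix.of_apply]
  fun_prop

/-- `toMatrix` as a measurable equivalence. -/
def toMatrixEquiv (n d : ℕ) :
    EuclideanSpace ℝ (Fin n × Fin d) ≃ᵐ Matrix (Fin n) (Fin d) ℝ where
  toFun := toMatrix
  invFun F := WithLp.toLp 2 fun p => F p.1 p.2
  left_inv _ := rfl
  right_inv _ := rfl
  measurable_toFun := (continuous_toMatrix n d).measurable
  measurable_invFun := by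
    have h : Continuous fun F : Matrix (Fin n) (Fin d) ℝ =>
        (WithLp.toLp 2 fun p => F p.1 p.2 : EuclideanSpace ℝ (Fin n × Fin d)) := by
      refine (PiLp.continuous_toLp 2 _).comp (continuous_pi fun p => ?_)
      exact continuous_id.matrix_elem _ _
    exact h.measurable

/-- Places of entries that determine a symmetric `n × n` matrix of rank `d`, when its rows `e a`
are linearly independent. -/
abbrev RankIndex {n d : ℕ} (e : Fin d → Fin n) : Type :=
  {p : Fin d × Fin d // p.1 ≤ p.2} ⊕ ({i : Fin n // ∀ a, e a ≠ i} × Fin d)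

theorem card_upperTriangle (d : ℕ) :
    Fintype.card {p : Fin d × Fin d // p.1 ≤ p.2} = d * (d + 1) / 2 := by
  let f : {p : Fin d × Fin d // p.1 ≤ p.2} ≃ Σ j : Fin d, Fin (j + 1) :=
    { toFun p := ⟨p.1.2, ⟨p.1.1, Nat.lt_succ_of_le p.2⟩⟩
      invFun s := ⟨(⟨s.2, lt_of_lt_of_le s.2.2 s.1.2⟩, s.1), Nat.le_of_lt_succ s.2.2⟩
      left_inv _ := rfl
      right_inv _ := rfl }
  rw [Fintype.card_congr f, Fintype.card_sigma]
  simp only [Fintype.card_fin]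
  rw [Fin.sum_univ_eq_sum_range fun j => j + 1, Finset.sum_add_distrib, Finset.sum_range_id]
  simp only [Finset.sum_const, Finset.card_range, smul_eq_mul, mul_one]
  -- The sum formula contains the truncated `d - 1`, so `d = 0` is separate.
  rcases d with - | d
  · rfl
  · rw [Nat.add_sub_cancel, ← Nat.add_mul_div_right _ _ two_pos]
    congr 1
    ring

theorem card_rankIndex {n d : ℕ} {e : Fin d → Fin n} (he : Function.Injective e) :
    Fintype.card (RankIndex e) = d * (d + 1) / 2 + (n - d) * d := by
  have h : Fintype.card {i : Fin n // ∀ a, e a ≠ i} = n - d := by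
    have h1 : Fintype.card {i : Fin n // ¬ ∃ a, e a = i} = n - d := by
      rw [Fintype.card_subtype_compl, Fintype.card_fin]
      congr 1
      have h2 : Nat.card {i // ∃ a, e a = i} = d :=
        (Nat.card_congr (Equiv.ofInjective e he)).symm.trans (Nat.card_fin d)
      rwa [Nat.card_eq_fintype_card] at h2
    rw [← h1]
    exact Fintype.card_congr (Equiv.subtypeEquivRight fun i => by simp)
  rw [Fintype.card_sum, Fintype.card_prod, card_upperTriangle, h, Fintype.card_fin]

/-- The two normalizations of Hausdorff measure differ by a nonzero finite factor. -/
theorem euclideanHausdorffMeasure_eq_zero_iff {X : Type*} [EMetricSpace X] [MeasurableSpace X]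
    [BorelSpace X] {k : ℕ} {s : Set X} : (μHE[k] : Measure X) s = 0 ↔ μH[k] s = 0 := by
  rw [Measure.euclideanHausdorffMeasure_def, Measure.smul_apply, smul_eq_zero]
  exact or_iff_right (Measure.addHaarScalarFactor_volume_hausdorffMeasure_ne_zero k)

theorem euclideanHausdorffMeasure_lt_top {X : Type*} [EMetricSpace X] [MeasurableSpace X]
    [BorelSpace X] {k : ℕ} {s : Set X} (h : μH[k] s < ⊤) : (μHE[k] : Measure X) s < ⊤ := by
  rw [Measure.euclideanHausdorffMeasure_def, Measure.smul_apply]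
  exact ENNReal.mul_lt_top ENNReal.coe_lt_top h

theorem measurable_symmetricOfUpper (n : ℕ) : Measurable (symmetricOfUpper (n := n)) := by
  refine measurable_pi_lambda _ fun i => measurable_pi_lambda _ fun j => ?_
  by_cases h : i ≤ j
  · simpa [symmetricOfUpper, h] using measurable_pi_apply _
  · simpa [symmetricOfUpper, h] using measurable_pi_apply _

theorem continuous_mul_transpose (n d : ℕ) :
    Continuous fun F : Matrix (Fin n) (Fin d) ℝ => F * Fᵀ :=
  Continuous.matrix_mul continuous_id (Continuous.matrix_transpose continuous_id)

theorem mul_transpose_mem_psdOfRank {n d r : ℕ} {F : Matrix (Fin n) (Fin d) ℝ}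
    (hF : F.rank = r) : F * Fᵀ ∈ psdOfRank n r := by
  refine ⟨?_, by rw [Matrix.rank_self_mul_transpose, hF]⟩
  simpa [Matrix.conjTranspose_eq_transpose_of_trivial] using
    Matrix.posSemidef_self_mul_conjTranspose F

theorem ae_rank_eq_min (n d : ℕ) :
    ∀ᵐ F : Matrix (Fin n) (Fin d) ℝ, F.rank = min n d := by
  filter_upwards [ae_det_submatrix_ne_zero (e := Fin.castLE (min_le_left n d))
    (e' := Fin.castLE (min_le_right n d)) (Fin.castLE_injective _) (Fin.castLE_injective _)]
    with F hF
  exact rank_eq_min_of_det_submatrix_ne_zero hF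

/-- The image of Lebesgue measure under `F ↦ F * Fᵀ` is absolutely continuous with respect to the
reference measure of the Wishart laws. -/
theorem map_mul_transpose_absolutelyContinuous (n d : ℕ) :
    (volume : Measure (Matrix (Fin n) (Fin d) ℝ)).map (fun F => F * Fᵀ) ≪
      wishartReference n d := by
  refine Measure.AbsolutelyContinuous.mk fun A hA h0 => ?_
  rw [Measure.map_apply (continuous_mul_transpose n d).measurable hA, measure_eq_zero_iff_ae_notMem]
  by_cases hnd : n ≤ d
  · rw [wishartReference, if_pos hnd, Measure.map_apply (measurable_symmetricOfUpper n) hA] at h0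
    filter_upwards [ae_gramEntries_notMem (d := d) Subtype.val_injective (fun x => x.2)
      (fun x => x.1.1.2.trans_le hnd) h0] with F hF hFA
    refine hF ?_
    have h1 : symmetricOfUpper (gramEntries Subtype.val F) = F * Fᵀ :=
      symmetricOfUpper_entries (T := F * Fᵀ) (by
        rw [Matrix.IsSymm, Matrix.transpose_mul, Matrix.transpose_transpose])
    rw [Set.mem_preimage, h1]
    exact hFA
  · have hdn : d ≤ n := (not_le.1 hnd).le
    let e : Fin d → Fin n := Fin.castLE hdn
    have he : Function.Injective e := Fin.castLE_injective _
    -- The places used are the upper triangle of the leading `d × d` block and the whole block to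
    -- its right.
    let q : RankIndex e → Fin n × Fin n :=
      Sum.elim (fun p => (e p.1.1, e p.1.2)) fun x => (e x.2, x.1)
    have hq : Function.Injective q := by
      rintro (⟨⟨a, b⟩, h⟩ | ⟨⟨i, hi⟩, a⟩) (⟨⟨a', b'⟩, h'⟩ | ⟨⟨i', hi'⟩, a'⟩) hx
      · simpa [q, he.eq_iff] using hx
      · exact absurd (Prod.ext_iff.1 hx).2 (hi' b)
      · exact absurd (Prod.ext_iff.1 hx).2.symm (hi b')
      · simpa [q, he.eq_iff, and_comm] using hx
    have hle : ∀ x, (q x).1 ≤ (q x).2 := by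
      rintro (⟨⟨a, b⟩, h⟩ | ⟨⟨i, hi⟩, a⟩)
      · exact h
      · refine Fin.le_def.2 (a.2.le.trans (not_lt.1 fun hlt => hi ⟨i, hlt⟩ rfl))
    have hlt : ∀ x, ((q x).1 : ℕ) < d := by
      rintro (⟨⟨a, b⟩, h⟩ | ⟨⟨i, hi⟩, a⟩)
      · exact a.2
      · exact a.2
    rw [wishartReference, if_neg hnd, Measure.restrict_apply hA] at h0
    have h1 := (toMatrixEquiv n n).map_apply (μ := μHE[d * (d + 1) / 2 + (n - d) * d])
      (A ∩ psdOfRank n d)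
    rw [show ⇑(toMatrixEquiv n n) = toMatrix from rfl] at h1
    rw [h1, euclideanHausdorffMeasure_eq_zero_iff, ← card_rankIndex he] at h0
    let π : EuclideanSpace ℝ (Fin n × Fin n) → RankIndex e → ℝ := fun x j => x (q j)
    have hπ : LipschitzWith 1 π := by
      refine LipschitzWith.of_dist_le_mul fun x y => ?_
      rw [NNReal.coe_one, one_mul]
      refine (dist_pi_le_iff dist_nonneg).2 fun j => ?_
      rw [dist_eq_norm, dist_eq_norm]
      exact PiLp.norm_apply_le (x - y) (q j)
    -- The exponent equals the number of coordinates kept, and in that dimension Hausdorff measure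
    -- for the sup metric is Lebesgue measure.
    have h2 : volume (π '' (toMatrix ⁻¹' (A ∩ psdOfRank n d))) = 0 := by
      rw [← hausdorffMeasure_pi_real]
      refine le_antisymm ((hπ.hausdorffMeasure_image_le (Nat.cast_nonneg _) _).trans ?_) zero_le
      rw [h0, mul_zero]
    filter_upwards [ae_gramEntries_notMem (d := d) hq hle hlt h2, ae_rank_eq_min n d]
      with F hF hr hFA
    rw [min_eq_right hdn] at hr
    refine hF ⟨(toMatrixEquiv n n).symm (F * Fᵀ), ⟨hFA, mul_transpose_mem_psdOfRank hr⟩, ?_⟩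
    rfl

end WishartModel

/-! ### Sigma-finiteness of the reference measure -/

namespace WishartModel

/-- Adding the complement of the union to the cover costs nothing, since `t` misses it; thus `t`
need not be measurable. -/
theorem sigmaFinite_restrict_of_subset_iUnion {α ι : Type*} [MeasurableSpace α] [Countable ι]
    {μ : Measure α} {t : Set α} {C : ι → Set α} (hC : ∀ i, MeasurableSet (C i))
    (hμ : ∀ i, μ (C i) < ⊤) (ht : t ⊆ ⋃ i, C i) : SigmaFinite (μ.restrict t) := by
  refine Measure.sigmaFinite_of_countable (S := insert (⋃ i, C i)ᶜ (Set.range C))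
    ((Set.countable_range C).insert _) ?_ ?_
  · rintro s (rfl | ⟨i, rfl⟩)
    · rw [Measure.restrict_apply (MeasurableSet.iUnion hC).compl,
        Set.disjoint_iff_inter_eq_empty.1 (Set.disjoint_compl_left_iff_subset.2 ht), measure_empty]
      exact ENNReal.zero_lt_top
    · exact (Measure.restrict_apply_le _ _).trans_lt (hμ i)
  · rw [Set.sUnion_insert, Set.sUnion_range, Set.compl_union_self]

/-- The matrix whose rows `e a` are the unit vectors and whose other rows are listed in `x`. -/
def rankFactor {n d : ℕ} (e : Fin d → Fin n) (x : RankIndex e → ℝ) : Matrix (Fin n) (Fin d) ℝ :=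
  Matrix.of fun i a => if h : ∀ b, e b ≠ i then x (.inr (⟨i, h⟩, a)) else if e a = i then 1 else 0

/-- The symmetric matrix of rank at most `d` determined by its entries on and above the diagonal in
the rows and columns `e a`, and by the coefficients of its other rows as combinations of the rows
`e a`. -/
def symmetricOfRankIndex {n d : ℕ} (e : Fin d → Fin n) (x : RankIndex e → ℝ) :
    Matrix (Fin n) (Fin n) ℝ :=
  rankFactor e x * symmetricOfUpper (fun p => x (.inl p)) * (rankFactor e x)ᵀ

theorem contDiff_symmetricOfRankIndex {n d : ℕ} (e : Fin d → Fin n) :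
    ContDiff ℝ 1 fun x => (WithLp.toLp 2 fun p => symmetricOfRankIndex e x p.1 p.2 :
      EuclideanSpace ℝ (Fin n × Fin n)) := by
  have h1 : ∀ i a, ContDiff ℝ 1 fun x => rankFactor e x i a := fun i a => by
    simp only [rankFactor, Matrix.of_apply]
    split_ifs <;> fun_prop
  have h2 : ∀ a b, ContDiff ℝ 1 fun x : RankIndex e → ℝ =>
      symmetricOfUpper (fun p => x (.inl p)) a b := fun a b => by
    simp only [symmetricOfUpper, Matrix.of_apply]
    split_ifs <;> fun_prop
  refine contDiff_euclidean.2 fun p => ?_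
  simp only [symmetricOfRankIndex, Matrix.mul_apply, Matrix.transpose_apply]
  exact ContDiff.sum fun b _ => (ContDiff.sum fun a _ => (h1 _ _).mul (h2 _ _)).mul (h1 _ _)

/-- Choose `d` rows `e` forming a basis of the row space and expand all rows in them: `T = Y T_e`.
By symmetry also `T = T_eᵀ Yᵀ`, whence `T = Y T_ee Yᵀ`. Positivity plays no role. -/
theorem exists_eq_symmetricOfRankIndex {n d : ℕ} {T : Matrix (Fin n) (Fin n) ℝ} (hT : T.IsSymm)
    (hr : T.rank = d) :
    ∃ e : Fin d → Fin n, Function.Injective e ∧ ∃ x, symmetricOfRankIndex e x = T := by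
  obtain ⟨f, hf, hspan, hind⟩ : ∃ f : Fin d → Fin n → ℝ, (∀ a, f a ∈ Set.range T.row) ∧
      Submodule.span ℝ (Set.range f) = Submodule.span ℝ (Set.range T.row) ∧
      LinearIndependent ℝ f := by
    subst hr
    rw [Matrix.rank_eq_finrank_span_row]
    exact Submodule.exists_fun_fin_finrank_span_eq ℝ (Set.range T.row)
  choose e he using hf
  have hinj : Function.Injective e := fun a b hab => hind.injective (by rw [← he, ← he, hab])
  have hY : ∀ i, ∃ y : Fin d → ℝ, ∑ a, y a • f a = T.row i ∧ ∀ a, e a = i → y = Pi.single a 1 := by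
    intro i
    by_cases h : ∃ a, e a = i
    · obtain ⟨a, rfl⟩ := h
      refine ⟨Pi.single a 1, ?_, fun b hb => by rw [hinj hb]⟩
      rw [Finset.sum_eq_single a (fun b _ hb => by simp [hb]) (by simp)]
      simp [he]
    · obtain ⟨y, hy⟩ := (Submodule.mem_span_range_iff_exists_fun ℝ).1
        (hspan ▸ Submodule.subset_span (Set.mem_range_self i) :
          T.row i ∈ Submodule.span ℝ (Set.range f))
      exact ⟨y, hy, fun a ha => absurd ⟨a, ha⟩ h⟩
  choose Y hY hYe using hY
  refine ⟨e, hinj, Sum.elim (fun p => T (e p.1.1) (e p.1.2)) fun x => Y x.1 x.2, ?_⟩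
  have h1 : T = Matrix.of Y * T.submatrix e id := by
    ext i j
    have := congrFun (hY i) j
    simp only [← he, Finset.sum_apply] at this
    exact this.symm
  have h2 : T.submatrix id e = Matrix.of Y * T.submatrix e e := congrArg (·.submatrix id e) h1
  have h3 : T = T.submatrix id e * (Matrix.of Y)ᵀ := by
    have := congrArg Matrix.transpose h1
    rwa [Matrix.transpose_mul, Matrix.transpose_submatrix, hT.eq] at this
  have h4 : rankFactor e (Sum.elim (fun p => T (e p.1.1) (e p.1.2)) fun x => Y x.1 x.2)
      = Matrix.of Y := by
    ext i a
    by_cases h : ∀ b, e b ≠ i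
    · simp [rankFactor, h]
    · obtain ⟨b, rfl⟩ := not_forall_not.1 h
      simp [rankFactor, hYe _ b rfl, hinj.eq_iff, Pi.single_apply]
  have h5 : symmetricOfUpper (fun p => T (e p.1.1) (e p.1.2)) = T.submatrix e e :=
    symmetricOfUpper_entries (T := T.submatrix e e)
      (by rw [Matrix.IsSymm, Matrix.transpose_submatrix, hT.eq])
  rw [symmetricOfRankIndex, h4]
  simp only [Sum.elim_inl]
  rw [h5, ← h2, ← h3]

/-- The charts `symmetricOfRankIndex e` are `C¹`, hence Lipschitz on compact balls, and the
parameter space has the dimension of the Hausdorff measure. The images of balls of integer radius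
therefore have finite measure. -/
theorem sigmaFinite_restrict_psdOfRank (n d : ℕ) :
    SigmaFinite (((μHE[d * (d + 1) / 2 + (n - d) * d] :
        Measure (EuclideanSpace ℝ (Fin n × Fin n))).map toMatrix).restrict (psdOfRank n d)) := by
  have key : SigmaFinite ((μHE[d * (d + 1) / 2 + (n - d) * d] :
      Measure (EuclideanSpace ℝ (Fin n × Fin n))).restrict (toMatrix ⁻¹' psdOfRank n d)) := by
    let C : {e : Fin d → Fin n // Function.Injective e} × ℕ →
        Set (EuclideanSpace ℝ (Fin n × Fin n)) := fun i =>
      (fun x => WithLp.toLp 2 fun p => symmetricOfRankIndex i.1.1 x p.1 p.2) ''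
        Metric.closedBall 0 i.2
    refine sigmaFinite_restrict_of_subset_iUnion (C := C) (fun i => ?_) (fun i => ?_) ?_
    · exact ((isCompact_closedBall _ _).image
        (contDiff_symmetricOfRankIndex i.1.1).continuous).measurableSet
    · refine euclideanHausdorffMeasure_lt_top ?_
      rw [← card_rankIndex i.1.2]
      obtain ⟨K, hK⟩ := (contDiff_symmetricOfRankIndex i.1.1).contDiffOn.exists_lipschitzOnWith
        one_ne_zero (convex_closedBall 0 (i.2 : ℝ)) (isCompact_closedBall _ _)
      refine (hK.hausdorffMeasure_image_le (Nat.cast_nonneg _)).trans_lt ?_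
      rw [hausdorffMeasure_pi_real]
      refine ENNReal.mul_lt_top ?_ (isCompact_closedBall _ _).measure_lt_top
      exact ENNReal.rpow_lt_top_of_nonneg (Nat.cast_nonneg _) ENNReal.coe_ne_top
    · intro T hT
      have hsymm : (toMatrix T).IsSymm := by
        have := hT.1.1
        rwa [Matrix.IsHermitian, Matrix.conjTranspose_eq_transpose_of_trivial] at this
      obtain ⟨e, he, x, hx⟩ := exists_eq_symmetricOfRankIndex hsymm hT.2
      obtain ⟨m, hm⟩ := exists_nat_ge ‖x‖
      refine Set.mem_iUnion.2 ⟨(⟨e, he⟩, m), x, mem_closedBall_zero_iff.2 hm, ?_⟩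
      simp only [hx]
      rfl
  rw [show toMatrix = ⇑(toMatrixEquiv n n) from rfl] at key ⊢
  rw [MeasurableEquiv.restrict_map]
  exact (toMatrixEquiv n n).sigmaFinite_map

instance sigmaFinite_wishartReference (n d : ℕ) : SigmaFinite (wishartReference n d) := by
  rw [wishartReference]
  split_ifs with h
  -- Reading off the upper entries inverts `symmetricOfUpper` on the left, so it pushes the
  -- reference measure to Lebesgue measure.
  · have hg : Measurable fun (T : Matrix (Fin n) (Fin n) ℝ)
        (p : {p : Fin n × Fin n // p.1 ≤ p.2}) => T p.1.1 p.1.2 :=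
      measurable_pi_lambda _ fun p => (continuous_id.matrix_elem _ _).measurable
    refine SigmaFinite.of_map _ hg.aemeasurable ?_
    rw [Measure.map_map hg (measurable_symmetricOfUpper n)]
    have h1 : ((fun (T : Matrix (Fin n) (Fin n) ℝ) (p : {p : Fin n × Fin n // p.1 ≤ p.2}) =>
        T p.1.1 p.1.2) ∘ symmetricOfUpper) = id :=
      funext fun u => funext fun p => symmetricOfUpper_apply u p
    rw [h1, Measure.map_id]
    infer_instance
  · exact sigmaFinite_restrict_psdOfRank n d

end WishartModel

/-! ### Gaussian densities -/

/-- The measure-theoretic form of sufficiency: a density that factors through `φ` descends to the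
image measure. -/
theorem map_withDensity_comp {α β : Type*} [MeasurableSpace α] [MeasurableSpace β] (μ : Measure α)
    {φ : α → β} (hφ : Measurable φ) {f : β → ENNReal} (hf : Measurable f) :
    (μ.withDensity fun x => f (φ x)).map φ = (μ.map φ).withDensity f := by
  ext s hs
  rw [Measure.map_apply hφ hs, withDensity_apply _ (hφ hs), withDensity_apply _ hs,
    setLIntegral_map hs hf hφ]

theorem MeasureTheory.Measure.exists_eq_smul_of_isAddHaarMeasure {E : Type*} [NormedAddCommGroup E]
    [NormedSpace ℝ E] [FiniteDimensional ℝ E] [MeasurableSpace E] [BorelSpace E]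
    (μ ν : Measure E) [μ.IsAddHaarMeasure] [ν.IsAddHaarMeasure] :
    ∃ c : ENNReal, c ≠ 0 ∧ c ≠ ⊤ ∧ μ = c • ν :=
  ⟨Measure.addHaarScalarFactor μ ν, ENNReal.coe_ne_zero.2
    (Measure.addHaarScalarFactor_pos_of_isAddHaarMeasure μ ν).ne', ENNReal.coe_ne_top,
    Measure.isAddLeftInvariant_eq_smul μ ν⟩

namespace ProbabilityTheory

variable {ι : Type*} [Fintype ι]

theorem pi_gaussianReal_eq_withDensity :
    Measure.pi (fun _ : ι => gaussianReal 0 1) =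
      volume.withDensity fun x => ENNReal.ofReal (∏ i, gaussianPDFReal 0 1 (x i)) := by
  refine (Measure.pi_eq fun s hs => ?_)
  rw [withDensity_apply _ (MeasurableSet.univ_pi hs)]
  have h0 : ∀ i, IntegrableOn (gaussianPDFReal 0 1) (s i) := fun i =>
    (integrable_gaussianPDFReal 0 1).integrableOn
  have h1 : (volume : Measure (ι → ℝ)).restrict (Set.univ.pi s)
      = Measure.pi fun i => volume.restrict (s i) := Measure.restrict_pi_pi _ s
  rw [h1, ← ofReal_integral_eq_lintegral_ofReal (Integrable.fintype_prod_dep h0)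
    (Filter.Eventually.of_forall fun x => Finset.prod_nonneg fun i _ =>
      gaussianPDFReal_nonneg 0 1 _), integral_fintype_prod_eq_prod,
    ENNReal.ofReal_prod_of_nonneg fun i _ => integral_nonneg fun x =>
      gaussianPDFReal_nonneg 0 1 x]
  exact Finset.prod_congr rfl fun i _ => (gaussianReal_apply_eq_integral 0 one_ne_zero (s i)).symm

theorem stdGaussian_eq_withDensity :
    stdGaussian (EuclideanSpace ℝ ι) = volume.withDensity fun x : EuclideanSpace ℝ ι =>
      ENNReal.ofReal ((√(2 * Real.pi))⁻¹ ^ Fintype.card ι * Real.exp (-(x ⬝ᵥ x) / 2)) := by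
  rw [← map_pi_eq_stdGaussian, pi_gaussianReal_eq_withDensity,
    ← (PiLp.volume_preserving_toLp ι).map_eq, ← map_withDensity_comp _ (by fun_prop)]
  · congr 2
    funext x
    congr 1
    simp only [gaussianPDFReal, NNReal.coe_one, mul_one, sub_zero]
    rw [Finset.prod_mul_distrib, Finset.prod_const, Finset.card_univ, ← Real.exp_sum]
    congr 2
    simp only [dotProduct, neg_div, Finset.sum_neg_distrib, Finset.sum_div, pow_two]
  · simp only [dotProduct]
    fun_prop

open scoped MatrixOrder in
-- The law is the image of the standard Gaussian under `A = √S`. The identity `|x|² = (A x)ᵀ S⁻¹ (A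
-- x)` makes the standard density a function of `A x`, and Lebesgue measure scales by `1 / det A`.
theorem multivariateGaussian_zero_eq_withDensity [DecidableEq ι] {S : Matrix ι ι ℝ}
    (hS : S.PosDef) :
    multivariateGaussian 0 S = volume.withDensity fun x : EuclideanSpace ℝ ι =>
      ENNReal.ofReal ((√(2 * Real.pi))⁻¹ ^ Fintype.card ι * (√S.det)⁻¹ *
        Real.exp (-(x ⬝ᵥ S⁻¹ *ᵥ x) / 2)) := by
  set A := CFC.sqrt S with hA
  have hAA : A * A = S := CFC.sqrt_mul_sqrt_self S hS.posSemidef.nonneg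
  have hApos : A.PosSemidef := Matrix.nonneg_iff_posSemidef.1 (CFC.sqrt_nonneg S)
  have hAt : Aᵀ = A := by
    have := hApos.1
    rwa [Matrix.IsHermitian, Matrix.conjTranspose_eq_transpose_of_trivial] at this
  have hdet : √S.det = A.det := by
    rw [← hAA, Matrix.det_mul, Real.sqrt_mul_self hApos.det_nonneg]
  have hdet0 : A.det ≠ 0 := by
    rw [← hdet]
    exact (Real.sqrt_pos.2 hS.det_pos).ne'
  let L : EuclideanSpace ℝ ι →ₗ[ℝ] EuclideanSpace ℝ ι := Matrix.toEuclideanLin A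
  have hLdet : LinearMap.det L = A.det := by
    rw [← LinearMap.det_toLin (EuclideanSpace.basisFun ι ℝ).toBasis]
    rfl
  have hL : (fun x : EuclideanSpace ℝ ι => 0 + Matrix.toEuclideanCLM (𝕜 := ℝ) A x) = L := by
    funext x
    rw [zero_add]
    rfl
  have hmap : (volume : Measure (EuclideanSpace ℝ ι)).map L
      = ENNReal.ofReal (√S.det)⁻¹ • volume := by
    rw [Measure.map_linearMap_addHaar_eq_smul_addHaar _ (by rwa [hLdet]), hLdet, ← hdet,
      abs_of_nonneg (inv_nonneg.2 (Real.sqrt_nonneg _))]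
  have hinv : A * (S⁻¹ * A) = 1 := by
    have h1 : A * (A⁻¹ * A⁻¹ * A) = 1 := by
      rw [Matrix.mul_assoc, Matrix.nonsing_inv_mul _ (isUnit_iff_ne_zero.2 hdet0), Matrix.mul_one,
        Matrix.mul_nonsing_inv _ (isUnit_iff_ne_zero.2 hdet0)]
    rwa [← hAA, Matrix.mul_inv_rev]
  have hquad : ∀ x : EuclideanSpace ℝ ι, x ⬝ᵥ x = L x ⬝ᵥ S⁻¹ *ᵥ (L x) := fun x => by
    have h1 : (L x).ofLp = A *ᵥ x := rfl
    rw [h1, Matrix.mulVec_mulVec, ← Matrix.vecMul_transpose, hAt, ← Matrix.dotProduct_mulVec,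
      Matrix.mulVec_mulVec, hinv, Matrix.one_mulVec]
  rw [multivariateGaussian, ← hA, hL, stdGaussian_eq_withDensity]
  simp only [hquad]
  have hmeas : Measurable fun x : EuclideanSpace ℝ ι =>
      ENNReal.ofReal ((√(2 * Real.pi))⁻¹ ^ Fintype.card ι *
        Real.exp (-(x ⬝ᵥ S⁻¹ *ᵥ x) / 2)) := by
    simp only [dotProduct, Matrix.mulVec]
    fun_prop
  rw [map_withDensity_comp _ L.continuous_of_finiteDimensional.measurable hmeas, hmap,
    withDensity_smul_measure, ← withDensity_smul _ hmeas]
  congr 1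
  funext x
  rw [Pi.smul_apply, smul_eq_mul, ← ENNReal.ofReal_mul (inv_nonneg.2 (Real.sqrt_nonneg _))]
  congr 1
  ring

end ProbabilityTheory

/-! ### The matrix normal density and its relation to the Wishart law -/

namespace WishartModel

/-- The density of the matrix normal law `MN(0, M, 1)` at `F`, up to a constant factor, as a
function of `T = F * Fᵀ`. -/
noncomputable def normalWeight {n : ℕ} (d : ℕ) (M T : Matrix (Fin n) (Fin n) ℝ) : ℝ :=
  (√(M.det ^ d))⁻¹ * Real.exp (-(M⁻¹ * T).trace / 2)

theorem normalWeight_pos {n : ℕ} (d : ℕ) {M : Matrix (Fin n) (Fin n) ℝ} (hM : M.PosDef)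
    (T : Matrix (Fin n) (Fin n) ℝ) : 0 < normalWeight d M T :=
  mul_pos (inv_pos.2 (Real.sqrt_pos.2 (pow_pos hM.det_pos d))) (Real.exp_pos _)

theorem continuous_normalWeight {n : ℕ} (d : ℕ) (M : Matrix (Fin n) (Fin n) ℝ) :
    Continuous fun T => normalWeight d M T := by
  unfold normalWeight
  fun_prop

theorem continuousOn_normalWeight {n : ℕ} (d : ℕ) (T : Matrix (Fin n) (Fin n) ℝ) :
    ContinuousOn (fun M => normalWeight d M T) {M | M.PosDef} := by
  have hdet : Continuous fun M : Matrix (Fin n) (Fin n) ℝ => M.det := continuous_id.matrix_det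
  have h1 : ContinuousOn (fun M : Matrix (Fin n) (Fin n) ℝ => M⁻¹) {M | M.PosDef} := by
    have h2 : ContinuousOn (fun M : Matrix (Fin n) (Fin n) ℝ => M.det⁻¹) {M | M.PosDef} :=
      hdet.continuousOn.inv₀ fun M hM => (Matrix.PosDef.det_pos hM).ne'
    have h3 : Continuous fun M : Matrix (Fin n) (Fin n) ℝ => M.adjugate :=
      continuous_id.matrix_adjugate
    simp only [Matrix.inv_def, Ring.inverse_eq_inv']
    exact h2.smul h3.continuousOn
  have h4 : ContinuousOn (fun M : Matrix (Fin n) (Fin n) ℝ => (√(M.det ^ d))⁻¹) {M | M.PosDef} :=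
    (Real.continuous_sqrt.comp (hdet.pow d)).continuousOn.inv₀ fun M hM =>
      (Real.sqrt_pos.2 (pow_pos (Matrix.PosDef.det_pos hM) d)).ne'
  have h5 : Continuous fun B : Matrix (Fin n) (Fin n) ℝ => Real.exp (-(B * T).trace / 2) := by
    fun_prop
  exact h4.mul (h5.comp_continuousOn h1)

/-- Uniqueness of Haar measure suffices: the value of the constant is irrelevant, as it is absorbed
into `K`. -/
theorem exists_map_toMatrix_volume (n d : ℕ) : ∃ c : ENNReal, c ≠ 0 ∧ c ≠ ⊤ ∧
    (volume : Measure (EuclideanSpace ℝ (Fin n × Fin d))).map toMatrix = c • volume := by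
  let f : EuclideanSpace ℝ (Fin n × Fin d) ≃ₗ[ℝ] (Fin n → Fin d → ℝ) :=
    { (toMatrixEquiv n d).toEquiv with
      map_add' := fun _ _ => rfl
      map_smul' := fun _ _ => rfl }
  have h := f.toContinuousLinearEquiv.isAddHaarMeasure_map volume
  exact @Measure.exists_eq_smul_of_isAddHaarMeasure (Fin n → Fin d → ℝ) _ _ _ _ _ _ volume h _

theorem dotProduct_kronecker_one_mulVec {n d : ℕ} (B : Matrix (Fin n) (Fin n) ℝ)
    (x : EuclideanSpace ℝ (Fin n × Fin d)) :
    x ⬝ᵥ (B ⊗ₖ (1 : Matrix (Fin d) (Fin d) ℝ)) *ᵥ x =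
      (B * (toMatrix x * (toMatrix x)ᵀ)).trace := by
  simp only [dotProduct, Matrix.mulVec, Matrix.trace, Matrix.diag, Matrix.mul_apply,
    Matrix.transpose_apply, toMatrix, Matrix.of_apply, Fintype.sum_prod_type,
    Matrix.kroneckerMap_apply, Matrix.one_apply, mul_ite, mul_one, mul_zero, ite_mul, zero_mul,
    Finset.sum_ite_eq, Finset.mem_univ, if_true, Finset.mul_sum]
  refine Finset.sum_congr rfl fun i _ => ?_
  rw [Finset.sum_comm]
  exact Finset.sum_congr rfl fun j _ => Finset.sum_congr rfl fun k _ => by ring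

/-- The matrix normal laws have densities that depend on `F` through `F * Fᵀ` only. -/
theorem exists_matrixNormal_eq_withDensity (n d : ℕ) : ∃ K : ℝ, 0 < K ∧
    ∀ M : Matrix (Fin n) (Fin n) ℝ, M.PosDef →
      (matrixNormal 0 M 1 : Measure (Matrix (Fin n) (Fin d) ℝ)) =
        volume.withDensity fun F => ENNReal.ofReal (K * normalWeight d M (F * Fᵀ)) := by
  obtain ⟨c, hc0, hc, hmap⟩ := exists_map_toMatrix_volume n d
  set k : ℝ := (√(2 * Real.pi))⁻¹ ^ Fintype.card (Fin n × Fin d)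
  refine ⟨c.toReal * k, mul_pos (ENNReal.toReal_pos hc0 hc) (by positivity), fun M hM => ?_⟩
  have h0 : (WithLp.toLp 2 fun p : Fin n × Fin d => (0 : Matrix (Fin n) (Fin d) ℝ) p.1 p.2) = 0 :=
    rfl
  have hmeas : Measurable fun F : Matrix (Fin n) (Fin d) ℝ =>
      ENNReal.ofReal (k * normalWeight d M (F * Fᵀ)) :=
    (((continuous_normalWeight d M).comp (continuous_mul_transpose n d)).const_mul
      k).measurable.ennreal_ofReal
  rw [matrixNormal, h0, multivariateGaussian_zero_eq_withDensity (hM.kronecker Matrix.PosDef.one),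
    Matrix.inv_kronecker, inv_one]
  simp only [dotProduct_kronecker_one_mulVec, Matrix.det_kronecker, Matrix.det_one, one_pow,
    mul_one, Fintype.card_fin, mul_assoc]
  have h1 := map_withDensity_comp volume (continuous_toMatrix n d).measurable hmeas
  simp only [normalWeight] at h1 hmeas ⊢
  rw [h1, hmap, withDensity_smul_measure, ← withDensity_smul _ hmeas]
  congr 1
  funext F
  rw [Pi.smul_apply, smul_eq_mul, ENNReal.ofReal_mul ENNReal.toReal_nonneg,
    ENNReal.ofReal_toReal hc]

/-- The Wishart law is the law of `F * Fᵀ` for a matrix normal `F`. -/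
theorem wishart_eq_map_matrixNormal {n : ℕ} (d : ℕ) {M : Matrix (Fin n) (Fin n) ℝ}
    (hM : M.PosDef) :
    wishart M d = (matrixNormal 0 M 1 : Measure (Matrix (Fin n) (Fin d) ℝ)).map
      fun F => F * Fᵀ := by
  have h0 : (WithLp.toLp 2 fun p : Fin n × Fin d => (0 : Matrix (Fin n) (Fin d) ℝ) p.1 p.2) = 0 :=
    rfl
  let g : (Fin d → EuclideanSpace ℝ (Fin n)) → EuclideanSpace ℝ (Fin n × Fin d) :=
    fun y => WithLp.toLp 2 fun p => y p.2 p.1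
  have hg : Measurable g := by
    refine Continuous.measurable ?_
    fun_prop
  -- Independent `N(0, M)` columns, stacked, have covariance `M ⊗ 1`; characteristic functions are
  -- compared.
  have key : (Measure.pi fun _ : Fin d =>
      (multivariateGaussian 0 M : Measure (EuclideanSpace ℝ (Fin n)))).map g =
      multivariateGaussian 0 (M ⊗ₖ (1 : Matrix (Fin d) (Fin d) ℝ)) := by
    refine Measure.ext_of_charFun (funext fun t => ?_)
    let t' : PiLp 2 fun _ : Fin d => EuclideanSpace ℝ (Fin n) :=
      WithLp.toLp 2 fun j => WithLp.toLp 2 fun i => t (i, j)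
    have h1 : charFun ((Measure.pi fun _ : Fin d =>
        (multivariateGaussian 0 M : Measure (EuclideanSpace ℝ (Fin n)))).map g) t =
        charFun ((Measure.pi fun _ : Fin d =>
          (multivariateGaussian 0 M : Measure (EuclideanSpace ℝ (Fin n)))).map
            (WithLp.toLp 2)) t' := by
      rw [charFun_apply, charFun_apply, integral_map hg.aemeasurable (by fun_prop),
        integral_map (by fun_prop) (by fun_prop)]
      refine integral_congr_ae (Filter.Eventually.of_forall fun y => ?_)
      have h2 : inner ℝ (g y) t = inner ℝ (WithLp.toLp 2 y : PiLp 2 _) t' := by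
        simp only [PiLp.inner_apply, Fintype.sum_prod_type, g, t']
        exact Finset.sum_comm
      simp only [h2]
    rw [h1, charFun_pi, charFun_multivariateGaussian (hM.kronecker Matrix.PosDef.one).posSemidef]
    simp only [charFun_multivariateGaussian hM.posSemidef, ← Complex.exp_sum]
    have h3 : t ⬝ᵥ (M ⊗ₖ (1 : Matrix (Fin d) (Fin d) ℝ)) *ᵥ t = ∑ j, t' j ⬝ᵥ M *ᵥ t' j := by
      simp only [dotProduct, Matrix.mulVec, Fintype.sum_prod_type, Matrix.kroneckerMap_apply,
        Matrix.one_apply, mul_ite, mul_one, mul_zero, ite_mul, zero_mul, Finset.sum_ite_eq,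
        Finset.mem_univ, if_true, t']
      exact Finset.sum_comm
    rw [h3]
    simp [Finset.sum_div]
  rw [matrixNormal, h0, ← key, Measure.map_map (continuous_toMatrix n d).measurable hg,
    Measure.map_map (continuous_mul_transpose n d).measurable
      ((continuous_toMatrix n d).measurable.comp hg), wishart]
  congr 1
  funext y
  ext i k
  simp [Matrix.sum_apply, Matrix.vecMulVec_apply, Matrix.mul_apply, toMatrix, g]

end WishartModel

/-! ### Wishart densities and uniqueness of versions -/

namespace WishartModel

/-- Full rank means that the smaller of the two Gram matrices has nonzero determinant. -/
theorem isOpen_setOf_rank_eq_min (n d : ℕ) :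
    IsOpen {F : Matrix (Fin n) (Fin d) ℝ | F.rank = min n d} := by
  have hdet : ∀ {m : ℕ} (A : Matrix (Fin m) (Fin m) ℝ), A.rank = m ↔ A.det ≠ 0 := fun {m} A => by
    rw [← isUnit_iff_ne_zero, ← Matrix.isUnit_iff_isUnit_det]
    refine ⟨fun h => ?_, fun h => by simpa using Matrix.rank_of_isUnit A h⟩
    rw [← Matrix.linearIndependent_rows_iff_isUnit, linearIndependent_iff_card_eq_finrank_span,
      Set.finrank, ← Matrix.rank_eq_finrank_span_row, h, Fintype.card_fin]
  rcases le_total n d with h | h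
  · have : {F : Matrix (Fin n) (Fin d) ℝ | F.rank = min n d} = {F | (F * Fᵀ).det ≠ 0} := by
      ext F
      rw [Set.mem_ofPred_eq, Set.mem_ofPred_eq, ← hdet, Matrix.rank_self_mul_transpose,
        min_eq_left h]
    rw [this]
    exact isOpen_ne.preimage (Continuous.matrix_det (continuous_mul_transpose n d))
  · have : {F : Matrix (Fin n) (Fin d) ℝ | F.rank = min n d} = {F | (Fᵀ * F).det ≠ 0} := by
      ext F
      rw [Set.mem_ofPred_eq, Set.mem_ofPred_eq, ← hdet, Matrix.rank_transpose_mul_self,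
        min_eq_right h]
    rw [this]
    exact isOpen_ne.preimage (Continuous.matrix_det
      ((Continuous.matrix_transpose continuous_id).matrix_mul continuous_id))

theorem ae_eq_of_isDensityFamily {n : ℕ} {α : Type*} [MeasurableSpace α]
    {P : Matrix (Fin n) (Fin n) ℝ → Measure α} {ν : Measure α} [SigmaFinite ν]
    {p q : α → Matrix (Fin n) (Fin n) ℝ → ℝ} (hp : IsDensityFamily P ν p)
    (hq : IsDensityFamily P ν q) {M : Matrix (Fin n) (Fin n) ℝ} (hM : M.PosDef) :
    ∀ᵐ x ∂ν, p x M = q x M := by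
  obtain ⟨h1, h2, h3⟩ := hp M hM
  obtain ⟨h4, h5, h6⟩ := hq M hM
  have h7 := (withDensity_eq_iff_of_sigmaFinite h1.ennreal_ofReal.aemeasurable
    h4.ennreal_ofReal.aemeasurable).1 (h3.symm.trans h6)
  filter_upwards [h7] with x hx
  exact (ENNReal.ofReal_eq_ofReal_iff (h2 x) (h5 x)).1 hx

/-- The Wishart laws have densities that are a multiple of the matrix normal densities, by a factor
that does not depend on the parameter. -/
theorem exists_wishart_density (n d : ℕ) : ∃ h : Matrix (Fin n) (Fin n) ℝ → ℝ,
    IsDensityFamily (fun M => wishart M d) (wishartReference n d)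
      (fun T M => h T * normalWeight d M T) ∧
    ∀ᵐ F : Matrix (Fin n) (Fin d) ℝ, 0 < h (F * Fᵀ) := by
  obtain ⟨K, hK, hN⟩ := exists_matrixNormal_eq_withDensity n d
  have hφ := (continuous_mul_transpose n d).measurable
  set ν := wishartReference n d
  have hone : (1 : Matrix (Fin n) (Fin n) ℝ).PosDef := Matrix.PosDef.one
  set W : Measure (Matrix (Fin n) (Fin n) ℝ) := wishart 1 d with hW
  have hmeas : ∀ M : Matrix (Fin n) (Fin n) ℝ, Measurable fun T => normalWeight d M T :=
    fun M => (continuous_normalWeight d M).measurable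
  have hNmeas : ∀ M : Matrix (Fin n) (Fin n) ℝ,
      Measurable fun F : Matrix (Fin n) (Fin d) ℝ => ENNReal.ofReal (K * normalWeight d M (F * Fᵀ)) :=
    fun M => (((hmeas M).comp hφ).const_mul K).ennreal_ofReal
  have hWN : W = (matrixNormal 0 1 1 : Measure (Matrix (Fin n) (Fin d) ℝ)).map fun F => F * Fᵀ :=
    wishart_eq_map_matrixNormal d hone
  have hWν : W ≪ ν := by
    rw [hWN, hN 1 hone]
    exact ((withDensity_absolutelyContinuous _ _).map hφ).trans
      (map_mul_transpose_absolutelyContinuous n d)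
  have hWprob : IsProbabilityMeasure W := by
    rw [hWN]
    have : IsProbabilityMeasure (matrixNormal 0 1 1 : Measure (Matrix (Fin n) (Fin d) ℝ)) :=
      Measure.isProbabilityMeasure_map (continuous_toMatrix n d).measurable.aemeasurable
    exact Measure.isProbabilityMeasure_map hφ.aemeasurable
  -- Here `h` is the density of `W(1, d)` divided by the weight at `M = 1`.
  refine ⟨fun T => (W.rnDeriv ν T).toReal * (normalWeight d 1 T)⁻¹, fun M hM => ?_, ?_⟩
  · refine ⟨((Measure.measurable_rnDeriv W ν).ennreal_toReal.mul (hmeas 1).inv).mul (hmeas M),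
      fun T => mul_nonneg (mul_nonneg ENNReal.toReal_nonneg
        (inv_nonneg.2 (normalWeight_pos d hone T).le)) (normalWeight_pos d hM T).le, ?_⟩
    set ρ : Matrix (Fin n) (Fin n) ℝ → ENNReal := fun T =>
      ENNReal.ofReal ((normalWeight d 1 T)⁻¹ * normalWeight d M T) with hρ
    have hρm : Measurable ρ := ((hmeas 1).inv.mul (hmeas M)).ennreal_ofReal
    have hρφ : Measurable fun F : Matrix (Fin n) (Fin d) ℝ => ρ (F * Fᵀ) := hρm.comp hφ
    have h1 : (matrixNormal 0 M 1 : Measure (Matrix (Fin n) (Fin d) ℝ)) =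
        (matrixNormal 0 1 1).withDensity fun F => ρ (F * Fᵀ) := by
      rw [hN M hM, hN 1 hone, ← withDensity_mul _ (hNmeas 1) hρφ]
      congr 1
      funext F
      rw [Pi.mul_apply, hρ, ← ENNReal.ofReal_mul
        (mul_nonneg hK.le (normalWeight_pos d hone _).le)]
      congr 1
      have := (normalWeight_pos d hone (F * Fᵀ)).ne'
      field_simp
    have h2 : wishart M d = W.withDensity ρ := by
      rw [wishart_eq_map_matrixNormal d hM, h1, map_withDensity_comp _ hφ hρm, ← hWN]
    have h3 : W.withDensity ρ = ν.withDensity (W.rnDeriv ν * ρ) := by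
      rw [withDensity_mul _ (Measure.measurable_rnDeriv W ν) hρm,
        Measure.withDensity_rnDeriv_eq W ν hWν]
    refine (h2.trans h3).trans ?_
    refine withDensity_congr_ae ?_
    filter_upwards [Measure.rnDeriv_lt_top W ν] with T hT
    rw [Pi.mul_apply, mul_assoc,
      ENNReal.ofReal_mul ENNReal.toReal_nonneg, ENNReal.ofReal_toReal hT.ne]
  · have h1 : ∀ᵐ T ∂W, 0 < (W.rnDeriv ν T).toReal * (normalWeight d 1 T)⁻¹ := by
      filter_upwards [Measure.rnDeriv_pos hWν, hWν.ae_le (Measure.rnDeriv_lt_top W ν)] with T h0 h1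
      exact mul_pos (ENNReal.toReal_pos h0.ne' h1.ne) (inv_pos.2 (normalWeight_pos d hone T))
    have h2 : ∀ p : Matrix (Fin n) (Fin n) ℝ → Prop, (∀ᵐ T ∂W, p T) →
        ∀ᵐ F ∂(matrixNormal 0 1 1 : Measure (Matrix (Fin n) (Fin d) ℝ)), p (F * Fᵀ) :=
      fun p hp => ae_of_ae_map hφ.aemeasurable (by rwa [← hWN])
    -- Positivity holds almost surely under the law of `F` at `M = 1`; that law has an everywhere
    -- positive density, so Lebesgue measure has no further null sets to fear.
    refine (?_ : (volume : Measure (Matrix (Fin n) (Fin d) ℝ)) ≪ matrixNormal 0 1 1).ae_le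
      (h2 _ h1)
    rw [hN 1 hone]
    exact withDensity_absolutelyContinuous' (hNmeas 1).aemeasurable
      (Filter.Eventually.of_forall fun F =>
        (ENNReal.ofReal_pos.2 (mul_pos hK (normalWeight_pos d hone _))).ne')

/-- The difference of logarithms is `log a - log b` at every parameter, so it can be read off at a
reference parameter `N`. -/
theorem logLikelihoodsAgree_of_eq_mul {n d : ℕ}
    {pF : Matrix (Fin n) (Fin d) ℝ → Matrix (Fin n) (Fin n) ℝ → ℝ}
    {pT : Matrix (Fin n) (Fin n) ℝ → Matrix (Fin n) (Fin n) ℝ → ℝ}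
    {F : Matrix (Fin n) (Fin d) ℝ} {M N : Matrix (Fin n) (Fin n) ℝ} {a b : ℝ}
    {w : Matrix (Fin n) (Fin n) ℝ → ℝ} (ha : 0 < a) (hb : 0 < b) (hM : 0 < w M) (hN : 0 < w N)
    (h1 : pF F M = a * w M) (h2 : pT (F * Fᵀ) M = b * w M)
    (h3 : pF F N = a * w N) (h4 : pT (F * Fᵀ) N = b * w N) :
    LogLikelihoodsAgree pF pT F M (Real.log (pF F N) - Real.log (pT (F * Fᵀ) N)) := by
  refine ⟨h1 ▸ mul_pos ha hM, h2 ▸ mul_pos hb hM, ?_⟩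
  rw [h1, h2, h3, h4, Real.log_mul ha.ne' hM.ne', Real.log_mul hb.ne' hM.ne',
    Real.log_mul ha.ne' hN.ne', Real.log_mul hb.ne' hN.ne']
  ring

end WishartModel

/-! ### The main theorem -/

open WishartModel in
theorem mainTheorem8 (n d : ℕ) :
    (∃ pF : Matrix (Fin n) (Fin d) ℝ → Matrix (Fin n) (Fin n) ℝ → ℝ,
      WishartModel.IsDensityFamily (fun M => WishartModel.matrixNormal 0 M 1) volume pF ∧
        WishartModel.ContinuousInParameter pF) ∧
    (∃ pT : Matrix (Fin n) (Fin n) ℝ → Matrix (Fin n) (Fin n) ℝ → ℝ,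
      WishartModel.IsDensityFamily (fun M => WishartModel.wishart M d)
          (WishartModel.wishartReference n d) pT ∧
        WishartModel.ContinuousInParameter pT) ∧
    ∀ (pF : Matrix (Fin n) (Fin d) ℝ → Matrix (Fin n) (Fin n) ℝ → ℝ)
      (pT : Matrix (Fin n) (Fin n) ℝ → Matrix (Fin n) (Fin n) ℝ → ℝ),
      WishartModel.IsDensityFamily (fun M => WishartModel.matrixNormal 0 M 1) volume pF →
      WishartModel.IsDensityFamily (fun M => WishartModel.wishart M d)
          (WishartModel.wishartReference n d) pT →
      ∃ c : Matrix (Fin n) (Fin d) ℝ → ℝ,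
        (∀ M : Matrix (Fin n) (Fin n) ℝ, M.PosDef →
          ∀ᵐ F : Matrix (Fin n) (Fin d) ℝ,
            WishartModel.LogLikelihoodsAgree pF pT F M (c F)) ∧
        (WishartModel.ContinuousInParameter pF → WishartModel.ContinuousInParameter pT →
          ∀ᵐ F : Matrix (Fin n) (Fin d) ℝ,
            ∀ M : Matrix (Fin n) (Fin n) ℝ, M.PosDef →
              WishartModel.LogLikelihoodsAgree pF pT F M (c F)) ∧
        ((∀ M : Matrix (Fin n) (Fin n) ℝ, M.PosDef →
            Continuous (fun F => pF F M) ∧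
            ContinuousOn (fun T => pT T M) (WishartModel.psdOfRank n (min n d)) ∧
            ∀ T ∈ WishartModel.psdOfRank n (min n d), 0 < pT T M) →
          ∀ F : Matrix (Fin n) (Fin d) ℝ, F.rank = min n d →
            ∀ M : Matrix (Fin n) (Fin n) ℝ, M.PosDef →
              WishartModel.LogLikelihoodsAgree pF pT F M (c F)) := by
  obtain ⟨K, hK, hN⟩ := exists_matrixNormal_eq_withDensity n d
  obtain ⟨h, hW, hpos⟩ := exists_wishart_density n d
  have hφ := continuous_mul_transpose n d
  have hone : (1 : Matrix (Fin n) (Fin n) ℝ).PosDef := Matrix.PosDef.one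
  have hcont : ∀ M : Matrix (Fin n) (Fin n) ℝ,
      Continuous fun F : Matrix (Fin n) (Fin d) ℝ => K * normalWeight d M (F * Fᵀ) := fun M =>
    ((continuous_normalWeight d M).comp hφ).const_mul K
  have hF : IsDensityFamily (fun M => (matrixNormal 0 M 1 : Measure (Matrix (Fin n) (Fin d) ℝ)))
      volume fun F M => K * normalWeight d M (F * Fᵀ) := fun M hM =>
    ⟨(hcont M).measurable, fun F => (mul_pos hK (normalWeight_pos d hM _)).le, hN M hM⟩
  refine ⟨⟨_, hF, fun F => (continuousOn_normalWeight d _).const_mul K⟩,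
    ⟨_, hW, fun T => (continuousOn_normalWeight d T).const_mul (h T)⟩, fun pF pT hpF hpT => ?_⟩
  have haeF : ∀ M : Matrix (Fin n) (Fin n) ℝ, M.PosDef → ∀ᵐ F : Matrix (Fin n) (Fin d) ℝ,
      pF F M = K * normalWeight d M (F * Fᵀ) := fun M hM => ae_eq_of_isDensityFamily hpF hF hM
  have haeT : ∀ M : Matrix (Fin n) (Fin n) ℝ, M.PosDef → ∀ᵐ F : Matrix (Fin n) (Fin d) ℝ,
      pT (F * Fᵀ) M = h (F * Fᵀ) * normalWeight d M (F * Fᵀ) := fun M hM =>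
    ae_of_ae_map hφ.measurable.aemeasurable ((map_mul_transpose_absolutelyContinuous n d).ae_le
      (ae_eq_of_isDensityFamily hpT hW hM))
  -- Reading `c` from the given versions at `M = 1`, rather than from `K` and `h`, lets one function
  -- serve all three senses, including the pointwise one.
  refine ⟨fun F => Real.log (pF F 1) - Real.log (pT (F * Fᵀ) 1), fun M hM => ?_, fun hcF hcT => ?_,
    fun hc => ?_⟩
  · filter_upwards [hpos, haeF M hM, haeF 1 hone, haeT M hM, haeT 1 hone] with F h0 h1 h2 h3 h4
    exact logLikelihoodsAgree_of_eq_mul (w := fun M => normalWeight d M (F * Fᵀ)) hK h0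
      (normalWeight_pos d hM _) (normalWeight_pos d hone _) h1 h3 h2 h4
  · have : Nonempty {M : Matrix (Fin n) (Fin n) ℝ | M.PosDef} := ⟨⟨1, hone⟩⟩
    have : SecondCountableTopology (Matrix (Fin n) (Fin n) ℝ) :=
      inferInstanceAs (SecondCountableTopology (Fin n → Fin n → ℝ))
    -- Countably many exceptional null sets suffice: equality on a dense sequence of parameters
    -- extends by continuity.
    let s := TopologicalSpace.denseSeq {M : Matrix (Fin n) (Fin n) ℝ | M.PosDef}
    have hs : DenseRange s := TopologicalSpace.denseRange_denseSeq _
    filter_upwards [hpos, ae_all_iff.2 fun k => haeF (s k) (s k).2,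
      ae_all_iff.2 fun k => haeT (s k) (s k).2] with F h0 h1 h2
    have h3 : ∀ M : Matrix (Fin n) (Fin n) ℝ, M.PosDef →
        pF F M = K * normalWeight d M (F * Fᵀ) := fun M hM =>
      congrFun (hs.equalizer (continuousOn_iff_continuous_domRestrict.1 (hcF F))
        (continuousOn_iff_continuous_domRestrict.1
          ((continuousOn_normalWeight d (F * Fᵀ)).const_mul K)) (funext h1)) ⟨M, hM⟩
    have h4 : ∀ M : Matrix (Fin n) (Fin n) ℝ, M.PosDef →
        pT (F * Fᵀ) M = h (F * Fᵀ) * normalWeight d M (F * Fᵀ) := fun M hM =>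
      congrFun (hs.equalizer (continuousOn_iff_continuous_domRestrict.1 (hcT (F * Fᵀ)))
        (continuousOn_iff_continuous_domRestrict.1
          ((continuousOn_normalWeight d (F * Fᵀ)).const_mul (h (F * Fᵀ)))) (funext h2)) ⟨M, hM⟩
    intro M hM
    exact logLikelihoodsAgree_of_eq_mul (w := fun M => normalWeight d M (F * Fᵀ)) hK h0
      (normalWeight_pos d hM _) (normalWeight_pos d hone _) (h3 M hM) (h4 M hM) (h3 1 hone)
      (h4 1 hone)
  · intro F hFr M hM
    have h1 : ∀ N : Matrix (Fin n) (Fin n) ℝ, N.PosDef →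
        pF F N = K * normalWeight d N (F * Fᵀ) := fun N hN' =>
      congrFun (((hc N hN').1.ae_eq_iff_eq volume (hcont N)).1 (haeF N hN')) F
    set U := {F : Matrix (Fin n) (Fin d) ℝ | F.rank = min n d}
    have hU : ∀ N : Matrix (Fin n) (Fin n) ℝ, N.PosDef →
        ContinuousOn (fun F : Matrix (Fin n) (Fin d) ℝ => pT (F * Fᵀ) N) U := fun N hN' =>
      (hc N hN').2.1.comp hφ.continuousOn fun F hF => mul_transpose_mem_psdOfRank hF
    have hw : ∀ N : Matrix (Fin n) (Fin n) ℝ,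
        Continuous fun F : Matrix (Fin n) (Fin d) ℝ => normalWeight d N (F * Fᵀ) := fun N =>
      (continuous_normalWeight d N).comp hφ
    -- Continuity of `h` is not available, so `h` is eliminated by cross-multiplying the formulas at
    -- `M` and at `1`. The result holds almost everywhere between continuous functions on an open
    -- set, hence everywhere on it.
    have h2 : Set.EqOn
        (fun F : Matrix (Fin n) (Fin d) ℝ => pT (F * Fᵀ) M * normalWeight d 1 (F * Fᵀ))
        (fun F => pT (F * Fᵀ) 1 * normalWeight d M (F * Fᵀ)) U := by
      refine Measure.eqOn_open_of_ae_eq (μ := volume) (ae_restrict_of_ae ?_)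
        (isOpen_setOf_rank_eq_min n d) ((hU M hM).mul (hw 1).continuousOn)
        ((hU 1 hone).mul (hw M).continuousOn)
      filter_upwards [haeT M hM, haeT 1 hone] with F h3 h4
      rw [h3, h4]
      ring
    have h3 : pT (F * Fᵀ) M * normalWeight d 1 (F * Fᵀ) =
        pT (F * Fᵀ) 1 * normalWeight d M (F * Fᵀ) :=
      h2 hFr
    have h4 := normalWeight_pos d hone (F * Fᵀ)
    have h5 := (hc 1 hone).2.2 _ (mul_transpose_mem_psdOfRank hFr)
    -- The positive number `pT (F * Fᵀ) 1 / w(1, F Fᵀ)` takes the place of `h (F * Fᵀ)`.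
    refine logLikelihoodsAgree_of_eq_mul (w := fun M => normalWeight d M (F * Fᵀ)) hK
      (div_pos h5 h4) (normalWeight_pos d hM _) h4 (h1 M hM) ?_ (h1 1 hone) ?_
    · field_simp
      exact h3
    · field_simp
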